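/- A permutation $\pi$ of $\{1,\dots,N\}$ is called \emph{alternating} if $\pi(1)<\pi(2)>\pi(3)<\pi(4)>\cdots$. It \emph{avoids} a pattern $p=p_1p_2\cdots p_k$ if there are no indices $i_1<i_2<\cdots<i_k$ such that $\pi(i_1)\pi(i_2)\cdots\pi(i_k)$ is order-isomorphic to $p$. Let $\mathfrak{A}_N(1342,2431)$ be the set of alternating permutations of $\{1,\dots,N\}$ that avoid both $1342$ and $2431$. For $n\ge 0$ let $u_n:=|\mathfrak{A}_{2n+1}(1342,2431)|$, and let $U(x):=\sum_{n=0}^{\infty}u_nx^n$. Then, as formal power series, $$U(x)=\frac{\sqrt{1-4x}}{\sqrt{1-4x}-2x}=\cfrac{1}{1-\cfrac{2x}{1-\cfrac{2x}{1-\cfrac{x}{1-\cfrac{x}{\ddots}}}}},$$ where $\sqrt{1-4x}$ denotes the power series with constant term $1$ whose square is $1-4x$, and the coefficients of the continued fraction are $2x,2x$ followed by $x,x,x,\dots$ forever. The infinite continued fraction is understood as the coefficientwise limit of its finite truncations. -/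

import Mathlib

namespace AltPerm

open PowerSeries

/-- A permutation `π(1) π(2) ⋯ π(n)` (indexed here by `Fin n`, so from `0`) is alternating (up-down)
if it starts with an ascent and then descents and ascents come in turn:
`π(1) < π(2) > π(3) < π(4) > ⋯`. -/
def IsAlternating {n : ℕ} (π : Equiv.Perm (Fin n)) : Prop :=
  ∀ (i : ℕ) (h : i + 1 < n),
    (Even i → π ⟨i, by omega⟩ < π ⟨i + 1, h⟩) ∧
    (Odd i → π ⟨i + 1, h⟩ < π ⟨i, by omega⟩)

/-- `π` contains the pattern `p = p₁ ⋯ pₖ` (a word with distinct letters) if some subsequence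
`π(i₁) ⋯ π(iₖ)`, `i₁ < ⋯ < iₖ`, is order-isomorphic to `p`. -/
def ContainsPattern {k n : ℕ} (p : Fin k → ℕ) (π : Equiv.Perm (Fin n)) : Prop :=
  ∃ f : Fin k → Fin n, StrictMono f ∧ ∀ a b : Fin k, π (f a) < π (f b) ↔ p a < p b

/-- The set of alternating permutations of length `n` avoiding both patterns `p` and `q`. -/
def alternatingAvoiders {k l : ℕ} (n : ℕ) (p : Fin k → ℕ) (q : Fin l → ℕ) :
    Set (Equiv.Perm (Fin n)) :=
  {π | IsAlternating π ∧ ¬ ContainsPattern p π ∧ ¬ ContainsPattern q π}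

/-- `uₙ`, the number of alternating permutations of length `2n+1` avoiding `1342` and `2431`. -/
noncomputable def u (n : ℕ) : ℕ :=
  (alternatingAvoiders (2 * n + 1) ![1, 3, 4, 2] ![2, 4, 3, 1]).ncard

/-- The ordinary generating function `U(x) = ∑ uₙ xⁿ`, as a formal power series. -/
noncomputable def U : ℚ⟦X⟧ := PowerSeries.mk fun n => (u n : ℚ)

/-- The formal power series `√(1 - 4x) = ∑ (1/2 choose n) (-4x)ⁿ`. -/
noncomputable def sqrtOneSubFourX : ℚ⟦X⟧ :=
  rescale (-4 : ℚ) (PowerSeries.binomialSeries ℚ (1 / 2 : ℚ))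

/-- `√(1 - 4x)` squares to `1 - 4x`. -/
theorem sqrtOneSubFourX_sq : sqrtOneSubFourX ^ 2 = 1 - 4 * X := by
  have h : PowerSeries.binomialSeries ℚ (1 / 2 : ℚ) * PowerSeries.binomialSeries ℚ (1 / 2 : ℚ) = 1 + X := by
    rw [← binomialSeries_add]
    have := binomialSeries_nat (R := ℚ) (A := ℚ) 1
    norm_num at this ⊢
    exact this
  have h4 : (C (-4 : ℚ) : ℚ⟦X⟧) = -4 := by
    rw [map_neg]; rfl
  rw [sqrtOneSubFourX, sq, ← map_mul, h, map_add, map_one, rescale_X, h4]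
  ring

/-- `√(1 - 4x)` is the square root with constant term `1`. -/
theorem constantCoeff_sqrtOneSubFourX : constantCoeff sqrtOneSubFourX = 1 := by
  rw [← coeff_zero_eq_constantCoeff_apply]
  simp [sqrtOneSubFourX, coeff_rescale, binomialSeries_coeff]

/-- The denominator `√(1 - 4x) - 2x` is invertible as a formal power series. -/
theorem constantCoeff_denominator_ne_zero :
    constantCoeff (sqrtOneSubFourX - 2 * X) ≠ 0 := by
  simp [constantCoeff_sqrtOneSubFourX]

/-- The finite continued fraction `1/(1 - c₀x/(1 - c₁x/(⋯ /(1 - c_{N-1}x))))`,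
a formal power series (it is `1` for `N = 0`). -/
noncomputable def stieltjesConvergent : (ℕ → ℚ) → ℕ → ℚ⟦X⟧
  | _, 0 => 1
  | c, N + 1 => (1 - C (c 0) * X * stieltjesConvergent (fun k => c (k + 1)) N)⁻¹

/-- Every denominator in a convergent is invertible as a formal power series. -/
theorem constantCoeff_stieltjes_denominator (a : ℚ) (F : ℚ⟦X⟧) :
    constantCoeff (1 - C a * X * F) = 1 := by
  simp

/-- `F = 1/(1 - c₀x/(1 - c₁x/(1 - ⋯)))`: the formal power series `F` is the limit of the finite
continued fractions, i.e. each coefficient of the latter is eventually equal to that of `F`. -/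
def IsStieltjesFraction (c : ℕ → ℚ) (F : ℚ⟦X⟧) : Prop :=
  ∀ d : ℕ, ∀ᶠ N in Filter.atTop, coeff d (stieltjesConvergent c N) = coeff d F

end AltPerm

namespace AltPerm

/-! Reversal preserves up-down words of odd length and exchanges 1342 with 2431. So among the words
counted by `u (n + 1)`, exactly half have the second largest letter M before the largest letter N
(`card_words_alternatingPair_eq_two_mul`). If M comes first, then N comes second and the remainder
is an arbitrary word counted by `u n` (`card_words_head_eq`). Otherwise the word is A M S N R with A
and R nonempty. A letter r of R turns any 132 in A into 2431, and the subsequences a M N r and a M b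
r force every letter of A above those of S and R. Hence A is any 132-avoiding up-down word (Catalan
many, by splitting at the maximum) and S N R is any shorter word of the original kind with more than
one letter (`card_words_head_ne`). With C the Catalan series this gives U = 1 + 2x(U + C(U - 1)).
Since √(1 - 4x) = 1 - 2xC, the closed form follows. The continued fraction unfolds from U = 1/(1 -
2x/√(1 - 4x)), 1/√(1 - 4x) = 1/(1 - 2xC) and C = 1/(1 - xC). -/

/-! ### Up-down words: splitting, reversal, relabelling. -/

/-- Words of odd length that are up-down: `w₁ < w₂ > w₃ < ⋯ > w_{2n+1}`. -/
def OddAlternating : List ℕ → Prop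
  | [] => False
  | [_] => True
  | [_, _] => False
  | a :: b :: c :: w => a < b ∧ c < b ∧ OddAlternating (c :: w)

/-- Words without a subsequence order-isomorphic to `132`. -/
def Avoids132 (w : List ℕ) : Prop :=
  ∀ a b c, [a, b, c].Sublist w → ¬ (a < c ∧ c < b)

/-- Words without a subsequence order-isomorphic to `1342`. -/
def Avoids1342 (w : List ℕ) : Prop :=
  ∀ a b c d, [a, b, c, d].Sublist w → ¬ (a < d ∧ d < b ∧ b < c)

/-- Words without a subsequence order-isomorphic to `2431`. -/
def Avoids2431 (w : List ℕ) : Prop :=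
  ∀ a b c d, [a, b, c, d].Sublist w → ¬ (d < a ∧ a < c ∧ c < b)

/-- Up-down words of odd length that avoid `132`. -/
def Alternating132 (w : List ℕ) : Prop := OddAlternating w ∧ Avoids132 w

/-- Up-down words of odd length that avoid `1342` and `2431`. -/
def AlternatingPair (w : List ℕ) : Prop :=
  OddAlternating w ∧ Avoids1342 w ∧ Avoids2431 w

open Classical in
/-- The arrangements of `0, …, m - 1` with property `P`. -/
noncomputable def words (m : ℕ) (P : List ℕ → Prop) : Finset (List ℕ) :=
  {w ∈ (List.range m).permutations.toFinset | P w}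

theorem mem_words {m : ℕ} {P : List ℕ → Prop} {w : List ℕ} :
    w ∈ words m P ↔ w.Perm (List.range m) ∧ P w := by
  simp [words, List.mem_permutations]

theorem OddAlternating.length_mod_two {w : List ℕ} (h : OddAlternating w) :
    w.length % 2 = 1 := by
  induction w using OddAlternating.induct with
  | case1 => exact h.elim
  | case2 => simp
  | case3 => exact h.elim
  | case4 a b c w ih =>
    have := ih h.2.2
    simp only [List.length_cons] at this ⊢
    omega

/-- A letter exceeding everything before it must sit at a peak, so both sides have odd length. Only
the descent into B needs a separate condition, because M need not be the maximum of the whole word.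
-/
theorem oddAlternating_append_cons {A B : List ℕ} {M : ℕ} (hA : A ≠ []) (hM : ∀ x ∈ A, x < M) :
    OddAlternating (A ++ M :: B) ↔
      OddAlternating A ∧ OddAlternating B ∧ ∀ b ∈ B.head?, b < M := by
  induction A using OddAlternating.induct with
  | case1 => exact absurd rfl hA
  | case2 a =>
    cases B with
    | nil => simp [OddAlternating]
    | cons c B =>
      have := hM a (by simp)
      simp [OddAlternating, this, and_comm]
  | case3 a b =>
    have := hM b (by simp)
    simp only [List.cons_append, List.nil_append, OddAlternating]
    constructor
    · intro h; omega
    · intro h; exact h.1.elim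
  | case4 a b c A ih =>
    have := ih (by simp) (fun x hx => hM x (by simp_all))
    simp only [List.cons_append, OddAlternating] at this ⊢
    rw [this]
    tauto

theorem oddAlternating_map {f : ℕ → ℕ} (hf : StrictMono f) (w : List ℕ) :
    OddAlternating (w.map f) ↔ OddAlternating w := by
  induction w using OddAlternating.induct with
  | case1 => rfl
  | case2 => simp [OddAlternating]
  | case3 => simp [OddAlternating]
  | case4 a b c w ih =>
    simp only [List.map_cons, OddAlternating, hf.lt_iff_lt] at ih ⊢
    rw [ih]

theorem OddAlternating.append_pair {w : List ℕ} {a b c : ℕ} (h : OddAlternating (w ++ [c]))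
    (hc : c < b) (ha : a < b) : OddAlternating (w ++ [c, b, a]) := by
  induction w using OddAlternating.induct with
  | case1 => exact ⟨hc, ha, trivial⟩
  | case2 => exact h.elim
  | case3 x y => exact ⟨h.1, h.2.1, hc, ha, trivial⟩
  | case4 x y z w ih => exact ⟨h.1, h.2.1, ih h.2.2⟩

theorem OddAlternating.reverse {w : List ℕ} (h : OddAlternating w) :
    OddAlternating w.reverse := by
  induction w using OddAlternating.induct with
  | case1 => exact h.elim
  | case2 => trivial
  | case3 => exact h.elim
  | case4 a b c w ih =>
    have h1 := ih h.2.2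
    rw [List.reverse_cons] at h1
    simpa using h1.append_pair h.2.1 h.1

theorem AlternatingPair.reverse {w : List ℕ} (h : AlternatingPair w) :
    AlternatingPair w.reverse := by
  refine ⟨h.1.reverse, fun a b c d hs hlt => h.2.2 d c b a ?_ ⟨hlt.1, hlt.2.1, hlt.2.2⟩,
    fun a b c d hs hlt => h.2.1 d c b a ?_ ⟨hlt.1, hlt.2.1, hlt.2.2⟩⟩ <;>
  simpa using hs.reverse

theorem alternating132_map {f : ℕ → ℕ} (hf : StrictMono f) (w : List ℕ) :
    Alternating132 (w.map f) ↔ Alternating132 w := by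
  refine and_congr (oddAlternating_map hf w) ⟨fun h a b c hs hlt => ?_, fun h a b c hs => ?_⟩
  · exact h (f a) (f b) (f c) (by simpa using hs.map f) ⟨hf hlt.1, hf hlt.2⟩
  · obtain ⟨l, hl, he⟩ := List.sublist_map_iff.1 hs
    obtain ⟨x, y, z, rfl⟩ : ∃ x y z, l = [x, y, z] := by
      rw [← List.length_eq_three, ← List.length_map (f := f), ← he]; rfl
    simp only [List.map_cons, List.map_nil, List.cons.injEq, and_true] at he
    obtain ⟨rfl, rfl, rfl⟩ := he
    simpa only [hf.lt_iff_lt] using h x y z hl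

theorem exists_of_quad_sublist_map {f : ℕ → ℕ} {w : List ℕ} {a b c d : ℕ}
    (hs : [a, b, c, d].Sublist (w.map f)) :
    ∃ x y z t, [x, y, z, t].Sublist w ∧ a = f x ∧ b = f y ∧ c = f z ∧ d = f t := by
  obtain ⟨l, hl, he⟩ := List.sublist_map_iff.1 hs
  match l, he with
  | [x, y, z, t], he => exact ⟨x, y, z, t, hl, by simpa using he⟩

theorem alternatingPair_map {f : ℕ → ℕ} (hf : StrictMono f) (w : List ℕ) :
    AlternatingPair (w.map f) ↔ AlternatingPair w := by
  refine and_congr (oddAlternating_map hf w) (and_congr ⟨fun h a b c d hs hlt => ?_,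
    fun h a b c d hs => ?_⟩ ⟨fun h a b c d hs hlt => ?_, fun h a b c d hs => ?_⟩)
  · exact h (f a) (f b) (f c) (f d) (by simpa using hs.map f)
      ⟨hf hlt.1, hf hlt.2.1, hf hlt.2.2⟩
  · obtain ⟨x, y, z, t, hl, rfl, rfl, rfl, rfl⟩ := exists_of_quad_sublist_map hs
    simpa only [hf.lt_iff_lt] using h x y z t hl
  · exact h (f a) (f b) (f c) (f d) (by simpa using hs.map f)
      ⟨hf hlt.1, hf hlt.2.1, hf hlt.2.2⟩
  · obtain ⟨x, y, z, t, hl, rfl, rfl, rfl, rfl⟩ := exists_of_quad_sublist_map hs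
    simpa only [hf.lt_iff_lt] using h x y z t hl

theorem exists_map_eq_of_perm_map {f : ℕ → ℕ} (hf : Function.Injective f) {w l : List ℕ}
    (h : w.Perm (l.map f)) : ∃ v : List ℕ, v.Perm l ∧ v.map f = w := by
  have hw : w ∈ Set.range (List.map f) := by
    rw [Set.range_list_map]
    intro x hx
    have := h.mem_iff.1 hx
    simp only [List.mem_map] at this
    obtain ⟨y, -, rfl⟩ := this
    exact ⟨y, rfl⟩
  obtain ⟨v, rfl⟩ := hw
  exact ⟨v, (List.map_perm_map_iff hf).1 h, rfl⟩

/-- Y is closed downwards among the letters, hence an initial interval; X is the complementary upper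
interval. -/
theorem perm_range_of_append {X Y : List ℕ} {m : ℕ} (h : (X ++ Y).Perm (List.range m))
    (hlt : ∀ x ∈ X, ∀ y ∈ Y, y < x) :
    Y.Perm (List.range Y.length) ∧ X.Perm ((List.range X.length).map (Y.length + ·)) := by
  have hnd : (X ++ Y).Nodup := h.nodup_iff.2 List.nodup_range
  have hY : Y.Nodup := (List.nodup_append.1 hnd).2.1
  have hlow : ∀ y ∈ Y, y < Y.length := by
    intro y hy
    have hsub : List.range (y + 1) ⊆ Y := by
      intro z hz
      rw [List.mem_range] at hz
      have hym : y < m := List.mem_range.1 (h.mem_iff.1 (List.mem_append_right X hy))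
      have hzm : z ∈ X ++ Y := h.mem_iff.2 (List.mem_range.2 (by omega))
      rcases List.mem_append.1 hzm with hzX | hzY
      · have := hlt z hzX y hy
        omega
      · exact hzY
    have := (List.subperm_of_subset List.nodup_range hsub).length_le
    simpa using this
  have hYp : Y.Perm (List.range Y.length) :=
    (List.subperm_of_subset hY fun y hy => List.mem_range.2 (hlow y hy)).perm_of_length_le
      (by simp)
  refine ⟨hYp, ?_⟩
  have hm : m = Y.length + X.length := by
    have := h.length_eq
    simp only [List.length_append, List.length_range] at this
    omega
  rw [hm, List.range_add] at h
  have h2 : (Y ++ X).Perm (Y ++ (List.range X.length).map (Y.length + ·)) :=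
    List.perm_append_comm.trans (h.trans (hYp.symm.append_right _))
  exact (List.perm_append_left_iff Y).1 h2

theorem triple_sublist_append {a b c : ℕ} {A B : List ℕ} :
    [a, b, c].Sublist (A ++ B) ↔ [a, b, c].Sublist B ∨ (a ∈ A ∧ [b, c].Sublist B) ∨
      ([a, b].Sublist A ∧ c ∈ B) ∨ [a, b, c].Sublist A := by
  simp [List.sublist_append_iff, List.cons_eq_append_iff, or_and_right, exists_or]

theorem quad_sublist_append {a b c d : ℕ} {A B : List ℕ} :
    [a, b, c, d].Sublist (A ++ B) ↔ [a, b, c, d].Sublist B ∨ (a ∈ A ∧ [b, c, d].Sublist B) ∨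
      ([a, b].Sublist A ∧ [c, d].Sublist B) ∨ ([a, b, c].Sublist A ∧ d ∈ B) ∨
      [a, b, c, d].Sublist A := by
  simp [List.sublist_append_iff, List.cons_eq_append_iff, or_and_right, exists_or]

theorem perm_range_of_append_cons {A B : List ℕ} {m : ℕ}
    (h : (A ++ m :: B).Perm (List.range (m + 1))) : (A ++ B).Perm (List.range m) := by
  have h1 := List.perm_middle.symm.trans h
  rw [List.range_succ] at h1
  exact (List.perm_cons m).1 (h1.trans (List.perm_append_singleton m _))

theorem append_cons_perm_range {A B : List ℕ} {m : ℕ}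
    (h : (A ++ B).Perm (List.range m)) : (A ++ m :: B).Perm (List.range (m + 1)) := by
  rw [List.range_succ]
  exact List.perm_middle.trans ((h.cons m).trans (List.perm_append_singleton m _).symm)

theorem OddAlternating.ne_nil {w : List ℕ} (h : OddAlternating w) : w ≠ [] := by
  rintro rfl
  exact h

/-! ### 132-avoiding up-down words and the Catalan recurrence. -/

theorem Alternating132.append_cons {A B : List ℕ} {N : ℕ} (hA : ∀ x ∈ A, x < N)
    (hB : ∀ x ∈ B, x < N) (hAB : ∀ a ∈ A, ∀ b ∈ B, b < a)
    (h1 : Alternating132 A) (h2 : Alternating132 B) : Alternating132 (A ++ N :: B) := by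
  refine ⟨(oddAlternating_append_cons h1.1.ne_nil hA).2
    ⟨h1.1, h2.1, fun b hb => hB b (List.mem_of_mem_head? hb)⟩, ?_⟩
  intro a b c hs hlt
  rw [triple_sublist_append] at hs
  rcases hs with hs | ⟨ha, hs⟩ | ⟨hs, hc⟩ | hs
  · rcases List.cons_sublist_cons'.1 hs with hs | ⟨rfl, hs'⟩
    · exact h2.2 a b c hs hlt
    · have := hB c (hs'.subset (by simp))
      omega
  · rcases List.cons_sublist_cons'.1 hs with hs | ⟨rfl, hs'⟩
    · have := hAB a ha c (hs.subset (by simp))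
      omega
    · have := hAB a ha c (hs'.subset (by simp))
      omega
  · have := hA b (hs.subset (by simp))
    rcases List.mem_cons.1 hc with rfl | hc
    · omega
    · have := hAB a (hs.subset (by simp)) c hc
      omega
  · exact h1.2 a b c hs hlt

theorem Alternating132.of_append_cons {A B : List ℕ} {n : ℕ}
    (hp : (A ++ (2 * n + 2) :: B).Perm (List.range (2 * n + 3)))
    (h : Alternating132 (A ++ (2 * n + 2) :: B)) :
    Alternating132 A ∧ Alternating132 B ∧ ∀ a ∈ A, ∀ b ∈ B, b < a := by
  have hAB := perm_range_of_append_cons hp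
  have hA : ∀ x ∈ A, x < 2 * n + 2 := fun x hx =>
    List.mem_range.1 (hAB.mem_iff.1 (List.mem_append_left B hx))
  have hB : ∀ x ∈ B, x < 2 * n + 2 := fun x hx =>
    List.mem_range.1 (hAB.mem_iff.1 (List.mem_append_right A hx))
  -- The maximum cannot come first, since a word of length at least 3 starts with an ascent.
  have hne : A ≠ [] := by
    rintro rfl
    match B, hp, h.1, hB with
    | [], hp, _, _ => have := hp.length_eq; simp at this
    | [b], _, h, _ => exact h
    | b :: c :: B, _, h, hB =>
      have := hB b (by simp)
      have := h.1
      omega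
  have hdisj : ∀ a ∈ A, ∀ b ∈ B, a ≠ b :=
    (List.nodup_append.1 (hAB.nodup_iff.2 List.nodup_range)).2.2
  have halt := (oddAlternating_append_cons hne hA).1 h.1
  refine ⟨⟨halt.1, fun a b c hs => h.2 a b c (hs.trans (List.sublist_append_left _ _))⟩,
    ⟨halt.2.1, fun a b c hs => h.2 a b c (hs.trans
      ((List.sublist_cons_self _ _).trans (List.sublist_append_right _ _)))⟩, fun a ha b hb => ?_⟩
  -- With a < b this would be a 132.
  have hs : [a, 2 * n + 2, b].Sublist (A ++ (2 * n + 2) :: B) :=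
    (List.singleton_sublist.2 ha).append ((List.singleton_sublist.2 hb).cons_cons _)
  have := h.2 _ _ _ hs
  have := hB b hb
  have := hdisj a ha b hb
  omega

/-- Splitting at the maximum leaves two odd 132-avoiding words; the left one is raised above the 2j
+ 1 letters of the right one. -/
theorem card_words_alternating132_succ (n : ℕ) :
    (words (2 * (n + 1) + 1) Alternating132).card =
      ∑ p ∈ Finset.HasAntidiagonal.antidiagonal n, (words (2 * p.1 + 1) Alternating132).card *
        (words (2 * p.2 + 1) Alternating132).card := by
  simp_rw [← Finset.card_product]
  rw [← Finset.card_sigma]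
  symm
  refine Finset.card_bij (fun x _ => x.2.1.map ((2 * x.1.2 + 1) + ·) ++ (2 * n + 2) :: x.2.2)
    ?_ ?_ ?_
  · rintro ⟨⟨i, j⟩, A, B⟩ hx
    simp only [Finset.mem_sigma, Finset.HasAntidiagonal.mem_antidiagonal, Finset.mem_product, mem_words] at hx ⊢
    obtain ⟨hij, ⟨hA, hA'⟩, hB, hB'⟩ := hx
    have hp : (A.map ((2 * j + 1) + ·) ++ B).Perm (List.range (2 * n + 2)) := by
      rw [show 2 * n + 2 = (2 * j + 1) + (2 * i + 1) by omega, List.range_add]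
      exact List.perm_append_comm.trans (hB.append (hA.map _))
    refine ⟨append_cons_perm_range hp, Alternating132.append_cons ?_ ?_ ?_
      ((alternating132_map (fun _ _ h => Nat.add_lt_add_left h _) A).2 hA') hB'⟩
    · exact fun x hx => List.mem_range.1 (hp.mem_iff.1 (List.mem_append_left B hx))
    · exact fun x hx => List.mem_range.1 (hp.mem_iff.1 (List.mem_append_right _ hx))
    · intro a ha b hb
      obtain ⟨x, -, rfl⟩ := List.mem_map.1 ha
      have := List.mem_range.1 (hB.mem_iff.1 hb)
      omega
  · rintro ⟨⟨i, j⟩, A, B⟩ hx ⟨⟨i', j'⟩, A', B'⟩ hx' heq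
    simp only [Finset.mem_sigma, Finset.HasAntidiagonal.mem_antidiagonal, Finset.mem_product, mem_words] at *
    obtain ⟨hij, ⟨hA, -⟩, hB, -⟩ := hx
    obtain ⟨hij', ⟨hA', -⟩, hB', -⟩ := hx'
    have hnA : 2 * n + 2 ∉ A.map ((2 * j + 1) + ·) := by
      intro h
      obtain ⟨x, hx, he⟩ := List.mem_map.1 h
      have := List.mem_range.1 (hA.mem_iff.1 hx)
      omega
    have hnB : 2 * n + 2 ∉ B := by
      intro h
      have := List.mem_range.1 (hB.mem_iff.1 h)
      omega
    obtain ⟨h1, -, rfl⟩ := (List.append_cons_inj_of_notMem hnA hnB).1 heq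
    have hl := hB.length_eq.symm.trans hB'.length_eq
    simp only [List.length_range] at hl
    obtain rfl : j = j' := by omega
    obtain rfl : i = i' := by omega
    have := List.map_injective_iff.2 (add_right_injective (2 * j + 1)) h1
    rw [this]
  · intro w hw
    rw [mem_words] at hw
    obtain ⟨hp, hw⟩ := hw
    obtain ⟨A, B, rfl⟩ := List.append_of_mem
      (hp.mem_iff.2 (List.mem_range.2 (show 2 * n + 2 < 2 * (n + 1) + 1 by omega)))
    obtain ⟨hA, hB, hAB⟩ := Alternating132.of_append_cons hp hw
    have hp' := perm_range_of_append_cons (m := 2 * n + 2) hp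
    obtain ⟨hBp, hAp⟩ := perm_range_of_append hp' hAB
    have hl := hp'.length_eq
    have hlA := hA.1.length_mod_two
    have hlB := hB.1.length_mod_two
    rw [List.length_append, List.length_range] at hl
    obtain ⟨i, hi⟩ : ∃ i, A.length = 2 * i + 1 := ⟨A.length / 2, by omega⟩
    obtain ⟨j, hj⟩ : ∃ j, B.length = 2 * j + 1 := ⟨B.length / 2, by omega⟩
    rw [hi, hj] at hAp
    rw [hj] at hBp
    obtain ⟨A₀, hA₀, rfl⟩ := exists_map_eq_of_perm_map (add_right_injective (2 * j + 1)) hAp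
    refine ⟨⟨(i, j), A₀, B⟩, ?_, rfl⟩
    simp only [Finset.mem_sigma, Finset.HasAntidiagonal.mem_antidiagonal, Finset.mem_product, mem_words]
    exact ⟨by omega,
      ⟨hA₀, (alternating132_map (fun _ _ h => Nat.add_lt_add_left h _) A₀).1 hA⟩, hBp, hB⟩

theorem words_one {P : List ℕ → Prop} (h : P [0]) : words 1 P = {[0]} := by
  ext w
  rw [mem_words, Finset.mem_singleton]
  constructor
  · rintro ⟨hw, -⟩
    exact List.perm_singleton.1 hw
  · rintro rfl
    exact ⟨List.Perm.refl _, h⟩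

theorem card_words_alternating132 (n : ℕ) :
    (words (2 * n + 1) Alternating132).card = catalan n := by
  induction n using Nat.strong_induction_on with
  | _ n ih =>
    cases n with
    | zero =>
      rw [catalan_zero, Nat.mul_zero, Nat.zero_add, words_one, Finset.card_singleton]
      refine ⟨trivial, fun a b c hs => ?_⟩
      have := hs.length_le
      simp at this
    | succ n =>
      rw [card_words_alternating132_succ, catalan_succ']
      refine Finset.sum_congr rfl fun p hp => ?_
      have := Finset.HasAntidiagonal.mem_antidiagonal.1 hp
      rw [ih p.1 (by omega), ih p.2 (by omega)]

/-! ### Words avoiding 1342 and 2431, split at the second largest letter. -/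

theorem AlternatingPair.cons_cons {B : List ℕ} {M N : ℕ} (hMN : M < N) (hB : ∀ x ∈ B, x < M)
    (h : AlternatingPair B) : AlternatingPair (M :: N :: B) := by
  refine ⟨?_, ?_, ?_⟩
  · match B, hB, h.1 with
    | c :: B, hB, h => exact ⟨hMN, (hB c (by simp)).trans hMN, h⟩
  · intro a b c d hs hlt
    rcases List.cons_sublist_cons'.1 hs with hs' | ⟨rfl, hs'⟩
    · rcases List.cons_sublist_cons'.1 hs' with hs'' | ⟨rfl, hs''⟩
      · exact h.2.1 a b c d hs'' hlt
      · have := hB d (hs''.subset (by simp))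
        omega
    · rcases List.cons_sublist_cons'.1 hs' with hs'' | ⟨rfl, hs''⟩
      · have := hB d (hs''.subset (by simp))
        omega
      · have := hB d (hs''.subset (by simp))
        omega
  · intro a b c d hs hlt
    rcases List.cons_sublist_cons'.1 hs with hs' | ⟨rfl, hs'⟩
    · rcases List.cons_sublist_cons'.1 hs' with hs'' | ⟨rfl, hs''⟩
      · exact h.2.2 a b c d hs'' hlt
      · have := hB c (hs''.subset (by simp))
        omega
    · rcases List.cons_sublist_cons'.1 hs' with hs'' | ⟨rfl, hs''⟩
      · have := hB c (hs''.subset (by simp))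
        omega
      · have := hB c (hs''.subset (by simp))
        omega

/-- Here S plays the role of the whole block S N R. In a pattern starting in A, the letter after A
that exceeds the first one can only be M or N, which leaves too few large letters to its left or
right; patterns with three letters in the right places of A contain a 132. The length condition
excludes S = [N], where M would be followed by an ascent. -/
theorem AlternatingPair.append_cons {A S : List ℕ} {M N : ℕ} (hMN : M < N)
    (hA : ∀ x ∈ A, x < M) (hS : ∀ s ∈ S, s ≠ N → s < M ∧ ∀ a ∈ A, s < a)
    (hlen : S.length ≠ 1) (h1 : Alternating132 A) (h2 : AlternatingPair S) :
    AlternatingPair (A ++ M :: S) := by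
  refine ⟨(oddAlternating_append_cons h1.1.ne_nil hA).2 ⟨h1.1, h2.1, ?_⟩, ?_, ?_⟩
  · match S, hS, hlen, h2.1 with
    | [_], _, hlen, _ => exact absurd rfl hlen
    | a :: b :: c :: S, hS, _, h =>
      intro x hx
      simp only [List.head?_cons, Option.mem_def, Option.some.injEq] at hx
      subst hx
      refine (hS a (by simp) ?_).1
      -- If N headed S, the second letter of S would have to exceed N.
      rintro rfl
      have := h.1
      have := (hS b (by simp) (by omega)).1
      omega
  · intro a b c d hs hlt
    have key : ∀ x ∈ M :: S, x = M ∨ x = N ∨ x < M ∧ ∀ a ∈ A, x < a := by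
      intro x hx
      rcases List.mem_cons.1 hx with rfl | hx
      · exact .inl rfl
      · by_cases hxN : x = N
        · exact .inr (.inl hxN)
        · exact .inr (.inr (hS x hx hxN))
    rw [quad_sublist_append] at hs
    rcases hs with hs | ⟨ha, hs⟩ | ⟨hs, hs'⟩ | ⟨hs, hd⟩ | hs
    · rcases List.cons_sublist_cons'.1 hs with hs | ⟨rfl, hs'⟩
      · exact h2.2.1 a b c d hs hlt
      · have hb := key b (List.mem_cons_of_mem _ (hs'.subset (by simp)))
        have hc := key c (List.mem_cons_of_mem _ (hs'.subset (by simp)))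
        omega
    · have hd := key d (hs.subset (by simp))
      have hb := key b (hs.subset (by simp))
      have hc := key c (hs.subset (by simp))
      have := hA a ha
      rcases hd with hd | hd | hd
      · omega
      · omega
      · have := hd.2 a ha
        omega
    · have hd := key d (hs'.subset (by simp))
      have ha := hs.subset (show a ∈ [a, b] by simp)
      have := hA b (hs.subset (by simp))
      rcases hd with hd | hd | hd
      · omega
      · omega
      · have := hd.2 a ha
        omega
    · have hd := key d hd
      have ha := hs.subset (show a ∈ [a, b, c] by simp)
      have := hA b (hs.subset (by simp))
      rcases hd with hd | hd | hd
      · omega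
      · omega
      · have := hd.2 a ha
        omega
    · exact h1.2 a b d (List.Sublist.trans (by simp) hs) ⟨hlt.1, hlt.2.1⟩
  · intro a b c d hs hlt
    have key : ∀ x ∈ M :: S, x = M ∨ x = N ∨ x < M ∧ ∀ a ∈ A, x < a := by
      intro x hx
      rcases List.mem_cons.1 hx with rfl | hx
      · exact .inl rfl
      · by_cases hxN : x = N
        · exact .inr (.inl hxN)
        · exact .inr (.inr (hS x hx hxN))
    rw [quad_sublist_append] at hs
    rcases hs with hs | ⟨ha, hs⟩ | ⟨hs, hs'⟩ | ⟨hs, hd⟩ | hs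
    · rcases List.cons_sublist_cons'.1 hs with hs | ⟨rfl, hs'⟩
      · exact h2.2.2 a b c d hs hlt
      · have hb := key b (List.mem_cons_of_mem _ (hs'.subset (by simp)))
        have hc := key c (List.mem_cons_of_mem _ (hs'.subset (by simp)))
        omega
    · have hb := key b (hs.subset (by simp))
      have hc := key c (hs.subset (by simp))
      have hcS : c ∈ S := by
        rcases List.cons_sublist_cons'.1 hs with hs | ⟨rfl, hs'⟩
        · exact hs.subset (by simp)
        · exact hs'.subset (by simp)
      have := hA a ha
      rcases hc with hc | hc | hc
      · have := (hS c hcS (by omega)).1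
        omega
      · omega
      · have := hc.2 a ha
        omega
    · have hc := key c (hs'.subset (by simp))
      have ha := hs.subset (show a ∈ [a, b] by simp)
      have := hA b (hs.subset (by simp))
      rcases hc with hc | hc | hc
      · omega
      · omega
      · have := hc.2 a ha
        omega
    · exact h1.2 a b c hs hlt.2
    · exact h1.2 a b c (List.Sublist.trans (by simp) hs) hlt.2

theorem AlternatingPair.of_append_cons {A S R : List ℕ} {M N : ℕ} (hMN : M < N)
    (hnd : (A ++ (S ++ R)).Nodup) (hM : ∀ x ∈ A ++ (S ++ R), x < M) (hne : A ≠ [])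
    (h : AlternatingPair (A ++ M :: (S ++ N :: R))) :
    Alternating132 A ∧ AlternatingPair (S ++ N :: R) ∧ R ≠ [] ∧
      ∀ a ∈ A, ∀ b ∈ S ++ R, b < a := by
  have hA : ∀ x ∈ A, x < M := fun x hx => hM x (by simp [hx])
  have halt := (oddAlternating_append_cons hne hA).1 h.1
  -- N exceeds all letters before it, so the part after it is an odd word.
  have hR : R ≠ [] := by
    have h' := h.1
    rw [← List.cons_append, ← List.append_assoc, oddAlternating_append_cons (by simp)] at h'
    · exact h'.2.1.ne_nil
    · intro x hx
      simp only [List.mem_append, List.mem_cons] at hx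
      rcases hx with hx | rfl | hx
      · exact (hA x hx).trans hMN
      · exact hMN
      · exact (hM x (by simp [hx])).trans hMN
  have hdisj := (List.nodup_append.1 hnd).2.2
  have hRA : ∀ a ∈ A, ∀ r ∈ R, r < a := by
    intro a ha r hr
    -- With a < r this would be a 1342.
    have hs : [a, M, N, r].Sublist (A ++ M :: (S ++ N :: R)) :=
      (List.singleton_sublist.2 ha).append (List.Sublist.cons_cons M
        (((List.singleton_sublist.2 hr).cons_cons N).trans (List.sublist_append_right _ _)))
    have h1 := h.2.1 _ _ _ _ hs
    have := hdisj a ha r (by simp [hr])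
    have := hM r (by simp [hr])
    omega
  obtain ⟨r, hr⟩ := List.exists_mem_of_ne_nil R hR
  refine ⟨⟨halt.1, fun a b c hs hlt => ?_⟩, ⟨halt.2.1, fun a b c d hs => h.2.1 a b c d (hs.trans
      ((List.sublist_cons_self _ _).trans (List.sublist_append_right _ _))),
      fun a b c d hs => h.2.2 a b c d (hs.trans
      ((List.sublist_cons_self _ _).trans (List.sublist_append_right _ _)))⟩, hR, ?_⟩
  · have := hRA a (hs.subset (by simp)) r hr
    -- A 132 in A followed by the smaller letter r is a 2431.
    exact h.2.2 a b c r (hs.append (List.singleton_sublist.2 (by simp [hr]))) ⟨this, hlt⟩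
  · intro a ha b hb
    rcases List.mem_append.1 hb with hb | hb
    -- With r < a < b this would be a 2431.
    · have hs : [a, M, b, r].Sublist (A ++ M :: (S ++ N :: R)) :=
        (List.singleton_sublist.2 ha).append (List.Sublist.cons_cons M
          ((List.singleton_sublist.2 hb).append (List.singleton_sublist.2 (by simp [hr]))))
      have h1 := h.2.2 _ _ _ _ hs
      have := hRA a ha r hr
      have := hdisj a ha b (by simp [hb])
      have := hM b (by simp [hb])
      omega
    · exact hRA a ha b hb

theorem pair_sublist_iff_mem {X Y : List ℕ} {M N : ℕ} (hX : N ∉ X) (hY : N ∉ Y) (hMN : M ≠ N) :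
    [M, N].Sublist (X ++ N :: Y) ↔ M ∈ X := by
  constructor
  · intro h
    simp only [List.sublist_append_iff, List.cons_eq_append_iff] at h
    obtain ⟨l₁, l₂, ⟨rfl, rfl⟩ | ⟨l, rfl, h⟩, h1, h2⟩ := h
    · rcases List.cons_sublist_cons'.1 h2 with h2 | ⟨rfl, -⟩
      · exact absurd (h2.subset (by simp)) hY
      · exact absurd rfl hMN
    · exact h1.subset (by simp)
  · intro h
    exact (List.singleton_sublist.2 h).append (List.singleton_sublist.2 (by simp))

theorem not_pair_sublist_iff {w : List ℕ} {M N : ℕ} (hw : w.Nodup) (hM : M ∈ w) (hN : N ∈ w)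
    (hMN : M ≠ N) : ¬ [M, N].Sublist w ↔ [M, N].Sublist w.reverse := by
  obtain ⟨X, Y, rfl⟩ := List.append_of_mem hN
  have hX : N ∉ X ∧ N ∉ Y ∧ (M ∈ X → M ∉ Y) := by
    rw [List.nodup_append] at hw
    simp only [List.nodup_cons, List.mem_cons] at hw
    grind
  rw [pair_sublist_iff_mem hX.1 hX.2.1 hMN, List.reverse_append, List.reverse_cons,
    List.append_assoc, List.singleton_append, pair_sublist_iff_mem (by simpa using hX.2.1)
    (by simpa using hX.1) hMN, List.mem_reverse]
  simp only [List.mem_append, List.mem_cons] at hM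
  tauto

/-! ### The recurrence for words avoiding both patterns. -/

theorem card_words_alternatingPair_eq_two_mul (n : ℕ) :
    (words (2 * n + 3) AlternatingPair).card = 2 * (words (2 * n + 3)
      fun w => AlternatingPair w ∧ [2 * n + 1, 2 * n + 2].Sublist w).card := by
  classical
  rw [← Finset.card_filter_add_card_filter_not (fun w => [2 * n + 1, 2 * n + 2].Sublist w), 
    two_mul (Finset.card _)]
  have hiff : ∀ w : List ℕ, w.Perm (List.range (2 * n + 3)) →
      (¬ [2 * n + 1, 2 * n + 2].Sublist w ↔ [2 * n + 1, 2 * n + 2].Sublist w.reverse) :=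
    fun w hw => not_pair_sublist_iff (hw.nodup_iff.2 List.nodup_range)
      (hw.mem_iff.2 (List.mem_range.2 (by omega))) (hw.mem_iff.2 (List.mem_range.2 (by omega)))
      (by omega)
  congr 1
  · congr 1
    ext w
    simp only [Finset.mem_filter, mem_words, and_assoc]
  · refine Finset.card_bij (fun w _ => w.reverse) ?_ (fun a _ b _ h => List.reverse_injective h) ?_
    · intro w hw
      simp only [Finset.mem_filter, mem_words] at hw ⊢
      exact ⟨(List.reverse_perm w).trans hw.1.1, hw.1.2.reverse, (hiff w hw.1.1).1 hw.2⟩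
    · intro w hw
      rw [mem_words] at hw
      have hp := (List.reverse_perm w).trans hw.1
      refine ⟨w.reverse, ?_, List.reverse_reverse w⟩
      simp only [Finset.mem_filter, mem_words]
      exact ⟨⟨hp, hw.2.1.reverse⟩, (hiff _ hp).2 (by rw [List.reverse_reverse]; exact hw.2.2)⟩

/-- The increasing map that fixes `0, …, k - 1` and shifts all other numbers by `c`. -/
def stretch (k c x : ℕ) : ℕ := if x < k then x else x + c

theorem strictMono_stretch (k c : ℕ) : StrictMono (stretch k c) := by
  intro x y h
  unfold stretch
  split_ifs <;> omega

/-- This relabels a standard word as the block S N R: the low letters stay and the top one becomes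
N, leaving room for the letters of A and M. -/
theorem map_stretch_range (k c : ℕ) :
    (List.range (k + 1)).map (stretch k c) = List.range k ++ [k + c] := by
  rw [List.range_succ, List.map_append]
  congr 1
  · rw [List.map_congr_left (g := id), List.map_id]
    intro x hx
    simp [stretch, List.mem_range.1 hx]
  · simp [stretch]

theorem card_words_head_eq (n : ℕ) :
    (words (2 * n + 3) fun w => (AlternatingPair w ∧ [2 * n + 1, 2 * n + 2].Sublist w) ∧
      w.head? = some (2 * n + 1)).card = (words (2 * n + 1) AlternatingPair).card := by
  symm
  refine Finset.card_bij (fun R _ => (2 * n + 1) :: (2 * n + 2) :: R) ?_ ?_ ?_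
  · intro R hR
    rw [mem_words] at hR ⊢
    refine ⟨append_cons_perm_range (A := [2 * n + 1]) (append_cons_perm_range (A := []) hR.1),
      ⟨hR.2.cons_cons (by omega) fun x hx => List.mem_range.1 (hR.1.mem_iff.1 hx), by simp⟩, rfl⟩
  · intro R _ R' _ h
    simpa using h
  · intro w hw
    rw [mem_words] at hw
    obtain ⟨hp, ⟨hw, -⟩, hh⟩ := hw
    match w, hp, hw, hh with
    | a :: w, hp, hw, hh =>
      obtain rfl : a = 2 * n + 1 := by simpa using hh
      match w, hp, hw with
      | [], hp, _ => have := hp.length_eq; simp at this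
      | [b], _, hw => exact hw.1.elim
      | b :: c :: w, hp, hw =>
        have h1 := hw.1.1
        have h2 := List.mem_range.1 (hp.mem_iff.1 (show b ∈ _ by simp))
        -- The word starts with an ascent, and only one letter exceeds 2n + 1.
        obtain rfl : b = 2 * n + 2 := by omega
        have hp' : (c :: w).Perm (List.range (2 * n + 1)) :=
          perm_range_of_append_cons (A := [])
            (perm_range_of_append_cons (A := [2 * n + 1]) (B := c :: w) hp)
        refine ⟨c :: w, ?_, rfl⟩
        rw [mem_words]
        exact ⟨hp', hw.1.2.2, fun a b c d hs => hw.2.1 a b c d ((hs.cons _).cons _),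
          fun a b c d hs => hw.2.2 a b c d ((hs.cons _).cons _)⟩

/-- A has 2i + 1 letters and S N R has 2j + 1, of which 2j are low. The letters of A are raised by
2j, and the top letter 2j of the second word is raised by 2i + 2 to N = 2n + 2. The case j = 0 would
put N directly after M. -/
theorem card_words_head_ne (n : ℕ) :
    (words (2 * n + 3) fun w => (AlternatingPair w ∧ [2 * n + 1, 2 * n + 2].Sublist w) ∧
      ¬ w.head? = some (2 * n + 1)).card =
      ∑ p ∈ Finset.HasAntidiagonal.antidiagonal n with p.2 ≠ 0,
        (words (2 * p.1 + 1) Alternating132).card * (words (2 * p.2 + 1) AlternatingPair).card := by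
  simp_rw [← Finset.card_product]
  rw [← Finset.card_sigma]
  symm
  have hmono : ∀ k : ℕ, StrictMono (k + ·) := fun k _ _ h => Nat.add_lt_add_left h k
  have hright : ∀ {S : List ℕ} {i j : ℕ}, i + j = n → S.Perm (List.range (2 * j + 1)) →
      (S.map (stretch (2 * j) (2 * i + 2))).Perm (List.range (2 * j) ++ [2 * n + 2]) := by
    intro S i j hij hS
    have := hS.map (stretch (2 * j) (2 * i + 2))
    rwa [map_stretch_range, show 2 * j + (2 * i + 2) = 2 * n + 2 by omega] at this
  have hleft : ∀ {A : List ℕ} {i j : ℕ}, i + j = n → A.Perm (List.range (2 * i + 1)) →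
      ∀ x ∈ A.map (2 * j + ·), x < 2 * n + 1 ∧ 2 * j ≤ x := by
    intro A i j hij hA x hx
    obtain ⟨y, hy, rfl⟩ := List.mem_map.1 hx
    have := List.mem_range.1 (hA.mem_iff.1 hy)
    omega
  refine Finset.card_bij (fun x _ => x.2.1.map (2 * x.1.2 + ·) ++
    (2 * n + 1) :: x.2.2.map (stretch (2 * x.1.2) (2 * x.1.1 + 2))) ?_ ?_ ?_
  · rintro ⟨⟨i, j⟩, A, S⟩ hx
    simp only [Finset.mem_sigma, Finset.mem_filter, Finset.HasAntidiagonal.mem_antidiagonal,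
      Finset.mem_product, mem_words] at hx ⊢
    obtain ⟨⟨hij, hj⟩, ⟨hA, hA'⟩, hS, hS'⟩ := hx
    have hAb := hleft hij hA
    have hSp := hright hij hS
    have hp : (A.map (2 * j + ·) ++ List.range (2 * j)).Perm (List.range (2 * n + 1)) := by
      rw [show 2 * n + 1 = 2 * j + (2 * i + 1) by omega, List.range_add]
      exact List.perm_append_comm.trans ((hA.map _).append_left _)
    have hp' : (A.map (2 * j + ·) ++ (2 * n + 1) :: (List.range (2 * j) ++ [2 * n + 2])).Perm
        (List.range (2 * n + 3)) := by
      have := append_cons_perm_range (B := []) (m := 2 * n + 2)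
        (by simpa using append_cons_perm_range hp)
      simpa using this
    have hne : A.map (2 * j + ·) ≠ [] := by simpa using hA'.1.ne_nil
    refine ⟨((hSp.cons _).append_left _).trans hp', ⟨?_, ?_⟩, ?_⟩
    · refine AlternatingPair.append_cons (N := 2 * n + 2) (by omega) (fun x hx => (hAb x hx).1)
        ?_ ?_ ((alternating132_map (hmono _) A).2 hA')
        ((alternatingPair_map (strictMono_stretch _ _) S).2 hS')
      · intro s hs hsN
        have hs' := hSp.mem_iff.1 hs
        rw [List.mem_append, List.mem_range, List.mem_singleton] at hs'
        refine ⟨by omega, fun a ha => ?_⟩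
        have := (hAb a ha).2
        omega
      · have := hSp.length_eq
        simp only [List.length_append, List.length_range, List.length_singleton] at this
        omega
    · refine (List.Sublist.cons_cons _ (List.singleton_sublist.2 ?_)).trans
        (List.sublist_append_right _ _)
      exact hSp.mem_iff.2 (by simp)
    · rw [List.head?_append_of_ne_nil _ hne]
      intro h
      have := (hAb _ (List.mem_of_mem_head? h)).1
      omega
  · rintro ⟨⟨i, j⟩, A, S⟩ hx ⟨⟨i', j'⟩, A', S'⟩ hx' heq
    simp only [Finset.mem_sigma, Finset.mem_filter, Finset.HasAntidiagonal.mem_antidiagonal,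
      Finset.mem_product, mem_words] at *
    obtain ⟨⟨hij, -⟩, ⟨hA, -⟩, hS, -⟩ := hx
    obtain ⟨⟨hij', -⟩, ⟨hA', -⟩, hS', -⟩ := hx'
    have hnA : 2 * n + 1 ∉ A.map (2 * j + ·) := fun h => by
      have := (hleft hij hA _ h).1
      omega
    have hnS : 2 * n + 1 ∉ S.map (stretch (2 * j) (2 * i + 2)) := by
      rw [(hright hij hS).mem_iff]
      simp
      omega
    obtain ⟨h1, -, h2⟩ := (List.append_cons_inj_of_notMem hnA hnS).1 heq
    have hl := congrArg List.length h2
    rw [List.length_map, List.length_map, hS.length_eq, hS'.length_eq] at hl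
    simp only [List.length_range] at hl
    obtain rfl : j = j' := by omega
    obtain rfl : i = i' := by omega
    rw [List.map_injective_iff.2 (hmono (2 * j)).injective h1,
      List.map_injective_iff.2 (strictMono_stretch _ _).injective h2]
  · intro w hw
    rw [mem_words] at hw
    obtain ⟨hp, ⟨hw, hs⟩, hh⟩ := hw
    have hnd := hp.nodup_iff.2 List.nodup_range
    obtain ⟨X, R, rfl⟩ := List.append_of_mem (hs.subset (show 2 * n + 2 ∈ _ by simp))
    have hN : 2 * n + 2 ∉ X ∧ 2 * n + 2 ∉ R := by
      rw [List.nodup_append] at hnd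
      simp only [List.nodup_cons, List.mem_cons] at hnd
      grind
    obtain ⟨A, S, rfl⟩ := List.append_of_mem ((pair_sublist_iff_mem hN.1 hN.2 (by omega)).1 hs)
    have hp1 := perm_range_of_append_cons (m := 2 * n + 2) hp
    rw [List.append_assoc, List.cons_append] at hp1
    have hp2 := perm_range_of_append_cons hp1
    rw [List.append_assoc, List.cons_append] at hw
    have hne : A ≠ [] := by
      rintro rfl
      exact hh rfl
    obtain ⟨hA, hS, hR, hAS⟩ := hw.of_append_cons (by omega) (hp2.nodup_iff.2 List.nodup_range)
      (fun x hx => List.mem_range.1 (hp2.mem_iff.1 hx)) hne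
    obtain ⟨hSp, hAp⟩ := perm_range_of_append hp2 hAS
    have hl := hp2.length_eq
    have hlA := hA.1.length_mod_two
    -- Nonemptiness of R is what gives j ≠ 0.
    have hlR := List.length_pos_of_ne_nil hR
    rw [List.length_append, List.length_range] at hl
    have hlSR : (S ++ R).length = S.length + R.length := List.length_append
    obtain ⟨i, hi⟩ : ∃ i, A.length = 2 * i + 1 := ⟨A.length / 2, by omega⟩
    obtain ⟨j, hj⟩ : ∃ j, (S ++ R).length = 2 * j := ⟨(S ++ R).length / 2, by omega⟩
    rw [hi, hj] at hAp
    rw [hj] at hSp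
    have hSp' : (S ++ (2 * n + 2) :: R).Perm
        ((List.range (2 * j + 1)).map (stretch (2 * j) (2 * i + 2))) := by
      rw [map_stretch_range, show 2 * j + (2 * i + 2) = 2 * n + 2 by omega]
      exact List.perm_middle.trans ((hSp.cons _).trans (List.perm_append_singleton _ _).symm)
    obtain ⟨A₀, hA₀, rfl⟩ := exists_map_eq_of_perm_map (hmono (2 * j)).injective hAp
    obtain ⟨S₀, hS₀, hS₀'⟩ := exists_map_eq_of_perm_map (strictMono_stretch _ _).injective hSp'
    rw [← hS₀'] at hS
    refine ⟨⟨(i, j), A₀, S₀⟩, ?_, ?_⟩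
    · simp only [Finset.mem_sigma, Finset.mem_filter, Finset.HasAntidiagonal.mem_antidiagonal,
        Finset.mem_product, mem_words]
      exact ⟨⟨by omega, by omega⟩, ⟨hA₀, (alternating132_map (hmono _) A₀).1 hA⟩, hS₀,
        (alternatingPair_map (strictMono_stretch _ _) S₀).1 hS⟩
    · simp [hS₀']

theorem card_words_alternatingPair_succ (n : ℕ) :
    (words (2 * (n + 1) + 1) AlternatingPair).card =
      2 * ((words (2 * n + 1) AlternatingPair).card +
        ∑ p ∈ Finset.HasAntidiagonal.antidiagonal n with p.2 ≠ 0,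
          catalan p.1 * (words (2 * p.2 + 1) AlternatingPair).card) := by
  classical
  simp_rw [← card_words_alternating132]
  rw [show 2 * (n + 1) + 1 = 2 * n + 3 by ring, card_words_alternatingPair_eq_two_mul,
    ← card_words_head_ne, ← card_words_head_eq,
    ← Finset.card_filter_add_card_filter_not (fun w : List ℕ => w.head? = some (2 * n + 1))]
  congr 3 <;>
  · ext w
    simp only [Finset.mem_filter, mem_words, and_assoc]

theorem card_words_alternatingPair_zero : (words 1 AlternatingPair).card = 1 := by
  rw [words_one, Finset.card_singleton]
  refine ⟨trivial, fun a b c d hs => ?_, fun a b c d hs => ?_⟩ <;>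
  · have := hs.length_le
    simp at this

/-! ### From words to permutations. -/

theorem oddAlternating_iff_getElem (w : List ℕ) : OddAlternating w ↔ w.length % 2 = 1 ∧
    ∀ (i : ℕ) (h : i + 1 < w.length), (Even i → w[i] < w[i + 1]) ∧ (Odd i → w[i + 1] < w[i]) := by
  induction w using OddAlternating.induct with
  | case1 => simp [OddAlternating]
  | case2 => simp [OddAlternating]
  | case3 => simp [OddAlternating]
  | case4 a b c w ih =>
    simp only [OddAlternating, ih]
    constructor
    · rintro ⟨h1, h2, h3, h4⟩
      refine ⟨by simp only [List.length_cons] at h3 ⊢; omega, fun i hi => ?_⟩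
      match i, hi with
      | 0, _ => simpa using h1
      | 1, _ => simpa using h2
      | i + 2, hi =>
        have := h4 i (by simpa using hi)
        simpa [Nat.even_add, Nat.odd_add] using this
    · rintro ⟨h3, h4⟩
      refine ⟨(h4 0 (by simp)).1 (by simp), (h4 1 (by simp)).2 (by simp),
        by simp only [List.length_cons] at h3 ⊢; omega, fun i hi => ?_⟩
      have := h4 (i + 2) (by simpa using hi)
      simpa [Nat.even_add, Nat.odd_add] using this

/-- The one-line notation of a permutation. -/
def oneLine {m : ℕ} (π : Equiv.Perm (Fin m)) : List ℕ := List.ofFn fun i => (π i : ℕ)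

theorem oneLine_injective (m : ℕ) : Function.Injective (oneLine (m := m)) := by
  intro π σ h
  ext i
  exact congrFun (List.ofFn_injective h) i

theorem oneLine_perm {m : ℕ} (π : Equiv.Perm (Fin m)) : (oneLine π).Perm (List.range m) := by
  have h : List.ofFn (Fin.val : Fin m → ℕ) = List.range m := by
    rw [List.ofFn_eq_map]
    simp
  rw [← h]
  exact Equiv.Perm.ofFn_comp_perm π Fin.val

theorem exists_oneLine_eq {m : ℕ} {w : List ℕ} (hw : w.Perm (List.range m)) :
    ∃ π : Equiv.Perm (Fin m), oneLine π = w := by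
  have hl : w.length = m := by simpa using hw.length_eq
  subst hl
  have hlt : ∀ i : Fin w.length, w[i] < w.length := fun i =>
    List.mem_range.1 (hw.mem_iff.1 (List.getElem_mem i.2))
  have hinj : Function.Injective fun i : Fin w.length => (⟨w[i], hlt i⟩ : Fin w.length) := by
    intro i j h
    exact List.nodup_iff_injective_get.1 (hw.nodup_iff.2 List.nodup_range) (Fin.mk.inj_iff.1 h)
  refine ⟨Equiv.ofBijective _ (Finite.injective_iff_bijective.1 hinj), ?_⟩
  simp [oneLine]

theorem oddAlternating_oneLine {n : ℕ} (π : Equiv.Perm (Fin (2 * n + 1))) :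
    OddAlternating (oneLine π) ↔ IsAlternating π := by
  rw [oddAlternating_iff_getElem]
  simp [oneLine, IsAlternating, Nat.add_mod, -List.ofFn_succ]

theorem quad_sublist_oneLine {m : ℕ} {π : Equiv.Perm (Fin m)} {a b c d : ℕ} :
    [a, b, c, d].Sublist (oneLine π) ↔ ∃ f : Fin 4 → Fin m, StrictMono f ∧
      a = π (f 0) ∧ b = π (f 1) ∧ c = π (f 2) ∧ d = π (f 3) := by
  have hl : (oneLine π).length = m := by simp [oneLine]
  rw [List.sublist_iff_exists_fin_orderEmbedding_get_eq]
  constructor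
  · rintro ⟨f, hf⟩
    refine ⟨fun i => Fin.cast hl (f i), fun i j h => f.strictMono h, ?_⟩
    have h0 := hf 0
    have h1 := hf 1
    have h2 := hf 2
    have h3 := hf 3
    simp only [oneLine, List.get_ofFn] at h0 h1 h2 h3
    exact ⟨h0, h1, h2, h3⟩
  · rintro ⟨f, hf, h0, h1, h2, h3⟩
    refine ⟨OrderEmbedding.ofStrictMono (fun i => Fin.cast hl.symm (f i)) fun i j h => hf h, ?_⟩
    intro i
    simp only [oneLine, List.get_ofFn]
    match i with
    | 0 => exact h0
    | 1 => exact h1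
    | 2 => exact h2
    | 3 => exact h3

theorem avoids1342_oneLine {m : ℕ} (π : Equiv.Perm (Fin m)) :
    Avoids1342 (oneLine π) ↔ ¬ ContainsPattern ![1, 3, 4, 2] π := by
  simp only [Avoids1342, quad_sublist_oneLine, ContainsPattern]
  constructor
  · rintro h ⟨f, hf, hlt⟩
    exact h _ _ _ _ ⟨f, hf, rfl, rfl, rfl, rfl⟩
      ⟨(hlt 0 3).2 (by decide), (hlt 3 1).2 (by decide), (hlt 1 2).2 (by decide)⟩
  · rintro h _ _ _ _ ⟨f, hf, rfl, rfl, rfl, rfl⟩ hlt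
    refine h ⟨f, hf, fun i j => ?_⟩
    rw [Fin.lt_def]
    fin_cases i <;> fin_cases j <;> simp <;> omega

theorem avoids2431_oneLine {m : ℕ} (π : Equiv.Perm (Fin m)) :
    Avoids2431 (oneLine π) ↔ ¬ ContainsPattern ![2, 4, 3, 1] π := by
  simp only [Avoids2431, quad_sublist_oneLine, ContainsPattern]
  constructor
  · rintro h ⟨f, hf, hlt⟩
    exact h _ _ _ _ ⟨f, hf, rfl, rfl, rfl, rfl⟩
      ⟨(hlt 3 0).2 (by decide), (hlt 0 2).2 (by decide), (hlt 2 1).2 (by decide)⟩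
  · rintro h _ _ _ _ ⟨f, hf, rfl, rfl, rfl, rfl⟩ hlt
    refine h ⟨f, hf, fun i j => ?_⟩
    rw [Fin.lt_def]
    fin_cases i <;> fin_cases j <;> simp <;> omega

theorem u_eq_card_words (n : ℕ) : u n = (words (2 * n + 1) AlternatingPair).card := by
  rw [u, ← Set.ncard_image_of_injective _ (oneLine_injective _), ← Set.ncard_coe_finset]
  congr 1
  ext w
  simp only [Set.mem_image, alternatingAvoiders, Set.mem_ofPred_eq, Finset.mem_coe, mem_words,
    ← avoids1342_oneLine, ← avoids2431_oneLine, ← oddAlternating_oneLine]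
  constructor
  · rintro ⟨π, h, rfl⟩
    exact ⟨oneLine_perm π, h⟩
  · rintro ⟨hp, h⟩
    obtain ⟨π, rfl⟩ := exists_oneLine_eq hp
    exact ⟨π, h, rfl⟩

theorem u_zero : u 0 = 1 := by
  rw [u_eq_card_words, card_words_alternatingPair_zero]

theorem u_succ (n : ℕ) : u (n + 1) = 2 * (u n +
    ∑ p ∈ Finset.HasAntidiagonal.antidiagonal n, catalan p.1 * if p.2 = 0 then 0 else u p.2) := by
  simp only [u_eq_card_words, card_words_alternatingPair_succ, Finset.sum_filter, mul_ite, mul_zero,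
    ne_eq, ite_not]

/-! ### The closed form of the generating function. -/

open PowerSeries

/-- The generating function of the Catalan numbers, with rational coefficients. -/
noncomputable def catalanQ : ℚ⟦X⟧ := PowerSeries.mk fun n => (catalan n : ℚ)

theorem catalanQ_eq : catalanQ = 1 + X * catalanQ * catalanQ := by
  have h := congrArg (PowerSeries.map (Nat.castRingHom ℚ)) catalanSeries_sq_mul_X_add_one
  have hc : PowerSeries.map (Nat.castRingHom ℚ) catalanSeries = catalanQ := by
    ext n
    simp [catalanQ]
  simp only [map_add, map_mul, map_pow, map_one, map_X, hc] at h
  linear_combination -h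

/-- Both sides square to 1 - 4x, and their sum has constant term 2, so it is not zero. -/
theorem sqrtOneSubFourX_eq : sqrtOneSubFourX = 1 - 2 * X * catalanQ := by
  have h : (sqrtOneSubFourX - (1 - 2 * X * catalanQ)) *
      (sqrtOneSubFourX + (1 - 2 * X * catalanQ)) = 0 := by
    linear_combination sqrtOneSubFourX_sq + 4 * X * catalanQ_eq
  rcases mul_eq_zero.1 h with h | h
  · exact sub_eq_zero.1 h
  · have := congrArg constantCoeff h
    simp [constantCoeff_sqrtOneSubFourX] at this

/-- The factor U - 1 reflects the missing term j = 0 in `u_succ`, as `u 0 = 1`. -/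
theorem U_eq : U = 1 + 2 * X * (U + catalanQ * (U - 1)) := by
  have hU : U - 1 = PowerSeries.mk fun n => ((if n = 0 then 0 else u n : ℕ) : ℚ) := by
    ext n
    cases n <;> simp [U, u_zero, coeff_one]
  rw [hU, show (2 : ℚ⟦X⟧) = C 2 from rfl]
  ext n
  cases n with
  | zero => simp [U, u_zero]
  | succ n =>
    rw [mul_assoc, map_add, coeff_C_mul, coeff_succ_X_mul, map_add, coeff_mul, coeff_one]
    simp only [U, catalanQ, coeff_mk, u_succ]
    push_cast
    simp

theorem U_mul_eq : U * (sqrtOneSubFourX - 2 * X) = sqrtOneSubFourX := by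
  rw [sqrtOneSubFourX_eq]
  linear_combination U_eq

/-! ### Convergence of the continued fraction. -/

/-- The difference of the reciprocals of 1 - c₀xS and 1 - c₀xG is their product times c₀x(S - G), so
each level gains one order of x. -/
theorem X_pow_dvd_stieltjesConvergent_succ {c : ℕ → ℚ} {N : ℕ} {F G : ℚ⟦X⟧}
    (hG : X ^ N ∣ stieltjesConvergent (fun k => c (k + 1)) N - G)
    (hF : F * (1 - C (c 0) * X * G) = 1) :
    X ^ (N + 1) ∣ stieltjesConvergent c (N + 1) - F := by
  obtain ⟨D, hD⟩ := hG
  set S := stieltjesConvergent (fun k => c (k + 1)) N with hS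
  have h1 : stieltjesConvergent c (N + 1) * (1 - C (c 0) * X * S) = 1 := by
    rw [stieltjesConvergent, PowerSeries.inv_mul_cancel]
    rw [constantCoeff_stieltjes_denominator]
    exact one_ne_zero
  refine ⟨stieltjesConvergent c (N + 1) * F * C (c 0) * D, ?_⟩
  linear_combination (-stieltjesConvergent c (N + 1)) * hF + F * h1 +
    stieltjesConvergent c (N + 1) * F * C (c 0) * X * hD

theorem X_pow_dvd_stieltjesConvergent_one (N : ℕ) :
    X ^ N ∣ stieltjesConvergent (fun _ => 1) N - catalanQ := by
  induction N with
  | zero => simp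
  | succ N ih =>
    refine X_pow_dvd_stieltjesConvergent_succ ih ?_
    rw [map_one]
    linear_combination catalanQ_eq

theorem X_pow_dvd_stieltjesConvergent_U (N : ℕ) :
    X ^ (N + 2) ∣ stieltjesConvergent (fun k => if k < 2 then 2 else 1) (N + 2) - U := by
  have h2 : (C 2 : ℚ⟦X⟧) = 2 := rfl
  have hs : constantCoeff sqrtOneSubFourX ≠ 0 := by simp [constantCoeff_sqrtOneSubFourX]
  have hne : sqrtOneSubFourX ≠ 0 := fun h => hs (by rw [h, map_zero])
  have hinv := PowerSeries.inv_mul_cancel sqrtOneSubFourX hs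
  -- The tails after removing one and two levels are 1/√(1 - 4x) and the Catalan series.
  refine X_pow_dvd_stieltjesConvergent_succ (G := sqrtOneSubFourX⁻¹)
    (X_pow_dvd_stieltjesConvergent_succ (G := catalanQ) ?_ ?_) ?_
  · simpa [add_assoc] using X_pow_dvd_stieltjesConvergent_one N
  · simp only [Nat.one_lt_ofNat, if_true, h2, Nat.zero_add]
    rw [← sqrtOneSubFourX_eq, hinv]
  · simp only [Nat.ofNat_pos, if_true, h2]
    refine mul_right_cancel₀ hne ?_
    linear_combination U_mul_eq - 2 * U * X * hinv

end AltPerm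

theorem mainTheorem11 :
    AltPerm.U =
        AltPerm.sqrtOneSubFourX * (AltPerm.sqrtOneSubFourX - 2 * PowerSeries.X)⁻¹ ∧
      AltPerm.IsStieltjesFraction (fun k => if k < 2 then 2 else 1) AltPerm.U := by
  refine ⟨?_, fun d => ?_⟩
  · rw [PowerSeries.eq_mul_inv_iff_mul_eq AltPerm.constantCoeff_denominator_ne_zero]
    exact AltPerm.U_mul_eq
  · filter_upwards [Filter.eventually_ge_atTop (d + 2)] with N hN
    obtain ⟨M, rfl⟩ := Nat.exists_eq_add_of_le' hN
    have h := PowerSeries.X_pow_dvd_iff.1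
      (AltPerm.X_pow_dvd_stieltjesConvergent_U (M + d)) d (by omega)
    rw [map_sub, sub_eq_zero] at h
    simpa only [add_assoc] using h
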